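/- Let $R$ be a commutative noetherian ring (with identity). For a commutative ring $S$, say that $S$ satisfies $(Q)$ if every $S$-module of finite composition length is a homomorphic image of an injective $S$-module, and say that $S$ is QF (quasi-Frobenius) if $S$ is noetherian and injective as a module over itself. Then the following are equivalent: 1. for every ideal $I$ of $R$, the factor ring $R/I$ satisfies $(Q)$; 2. $R$ is super QF, that is, for every ideal $I$ of $R$, the factor ring $R/I$ is QF. -/

import Mathlib

universe u

/-- Condition (Q) on a commutative ring `R`: every `R`-module of finite (composition) length is a
homomorphic image of an injective `R`-module. (Over a commutative ring right modules are the same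
as modules. A module of finite length is finitely generated, so modules in the universe of `R`
represent all isomorphism classes of them; for modules in that universe `Module.Injective` is
injectivity in the full sense, by Baer's criterion.) -/
def SatisfiesQ (R : Type u) [CommRing R] : Prop :=
  ∀ (M : Type u) [AddCommGroup M] [Module R M], IsFiniteLength R M →
    ∃ (E : Type u) (_ : AddCommGroup E) (_ : Module R E),
      Module.Injective R E ∧ ∃ f : E →ₗ[R] M, Function.Surjective f

/-- A (commutative) ring is QF (quasi-Frobenius) if it is noetherian and self-injective. -/
def IsQFRing (R : Type u) [CommRing R] : Prop :=
  IsNoetherianRing R ∧ Module.Injective R R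

/-- A (commutative) ring is super QF if each of its factor rings is QF. -/
def IsSuperQFRing (R : Type u) [CommRing R] : Prop :=
  ∀ I : Ideal R, IsQFRing (R ⧸ I)

/-! Applied to prime quotients, `(Q)` makes them fields, so `R` has dimension 0 and is artinian.
Each `R ⧸ I` then has finite length over itself, hence is a quotient of an injective; being free, it
splits off. Conversely, finite free modules over a QF ring are injective. -/

/-- Injective modules are divisible by non-zero-divisors. -/
theorem Module.Injective.exists_smul_eq {R E : Type u} [CommRing R] [AddCommGroup E] [Module R E]
    (hE : Module.Injective R E) {a : R} (ha : a ∈ nonZeroDivisors R) (e : E) :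
    ∃ x : E, a • x = e := by
  have hinj : Function.Injective (LinearMap.toSpanSingleton R R a) := fun x y hxy =>
    mul_cancel_right_mem_nonZeroDivisors ha |>.mp (by simpa using hxy)
  obtain ⟨h, hh⟩ := hE.out _ hinj (LinearMap.toSpanSingleton R E e)
  refine ⟨h 1, ?_⟩
  simpa [← map_smul] using hh 1

/-- A retract of an injective module is injective. -/
theorem Module.Injective.of_retract {R E M : Type u} [CommRing R] [AddCommGroup E] [Module R E]
    [AddCommGroup M] [Module R M] (hE : Module.Injective R E) (f : E →ₗ[R] M) (g : M →ₗ[R] E)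
    (hfg : f ∘ₗ g = LinearMap.id) : Module.Injective R M where
  out X Y _ _ _ _ i hi φ := by
    obtain ⟨h, hh⟩ := hE.out i hi (g ∘ₗ φ)
    refine ⟨f ∘ₗ h, fun x => ?_⟩
    simpa [hh] using LinearMap.congr_fun hfg (φ x)

/-- Over a self-injective ring, every module of finite length is a quotient of an injective. -/
theorem SatisfiesQ.of_injective_self {R : Type u} [CommRing R] (hR : Module.Injective R R) :
    SatisfiesQ R := by
  intro M _ _ hM
  have : IsNoetherian R M := (isFiniteLength_iff_isNoetherian_isArtinian.mp hM).1
  obtain ⟨n, f, hf⟩ := Module.Finite.exists_fin' R M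
  exact ⟨Fin n → R, inferInstance, inferInstance, inferInstance, f, hf⟩

/-- A domain satisfying `(Q)` is a field. -/
theorem SatisfiesQ.isField {D : Type u} [CommRing D] [IsDomain D] (hD : SatisfiesQ D) :
    IsField D := by
  by_contra hnf
  obtain ⟨m, hm⟩ := Ideal.exists_maximal D
  obtain ⟨a, ham, ha0⟩ := Submodule.exists_mem_ne_zero_of_ne_bot
    (Ring.ne_bot_of_isMaximal_of_not_isField hm hnf)
  have : IsSimpleModule D (D ⧸ m) := isSimpleModule_iff_isCoatom.mpr hm.out
  obtain ⟨E, _, _, hE, f, hf⟩ := hD (D ⧸ m)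
    (isFiniteLength_iff_isNoetherian_isArtinian.mpr ⟨inferInstance, inferInstance⟩)
  obtain ⟨e, he⟩ := hf 1
  obtain ⟨x, rfl⟩ := hE.exists_smul_eq (mem_nonZeroDivisors_of_ne_zero ha0) e
  obtain ⟨y, hy⟩ := Ideal.Quotient.mk_surjective (f x)
  -- Since `a ∈ m` kills `D ⧸ m`, `1 = f (a • x) = a • f x = 0`.
  rw [map_smul, ← hy, ← Ideal.Quotient.mk_eq_mk, ← Submodule.Quotient.mk_smul, smul_eq_mul,
    (Submodule.Quotient.mk_eq_zero m).mpr (m.mul_mem_right y ham)] at he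
  exact zero_ne_one he

/-- An artinian ring satisfying `(Q)` is self-injective. -/
theorem SatisfiesQ.injective_self {R : Type u} [CommRing R] [IsArtinianRing R]
    (hR : SatisfiesQ R) : Module.Injective R R := by
  obtain ⟨E, _, _, hE, f, hf⟩ := hR R ((isArtinianRing_iff_isFiniteLength R).mp ‹_›)
  obtain ⟨g, hg⟩ := Module.projective_lifting_property f LinearMap.id hf
  exact hE.of_retract f g hg

theorem proposition3p10 (R : Type u) [CommRing R] [IsNoetherianRing R] :
    (∀ I : Ideal R, SatisfiesQ (R ⧸ I)) ↔ IsSuperQFRing R := by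
  refine ⟨fun h I => ?_, fun h I => .of_injective_self (h I).2⟩
  have hdim : Ring.KrullDimLE 0 R := .mk₀ fun p _ =>
    Ideal.Quotient.maximal_of_isField p (h p).isField
  have : IsArtinianRing R := isArtinianRing_iff_krullDimLE_zero.mpr hdim
  exact ⟨inferInstance, (h I).injective_self⟩
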